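/- Let $1\le k<n$ be integers and $K=\{p\in[0,1]^n:\sum_i p_i=k\}$. For $U\subseteq[n]$ let $e_U\in\{0,1\}^n$ be its indicator vector, and for $|U|=k$ put $$g_U(p)=\frac1{n-k}\prod_{i\in U}p_i\prod_{i\notin U}(1-p_i)\sum_{i\notin U}p_i,\qquad f_U(p)=\frac{g_U(p)}{\sum_{|V|=k}g_V(p)},$$ so that $g_U(p)$ is the probability that one round of Sampford sampling with coins of biases $p_1,\dots,p_n$ outputs $U$, and $f_U(p)$ is the probability that Sampford sampling outputs $U$. Let $\overline f_U:K\to[0,1]$ be $1$ at $e_U$, $0$ at $e_V$ for $V\ne U$, and $f_U$ at all other points of $K$. A factory with outputs in a set $\mathcal O$ is a possibly infinite rooted binary tree each of whose internal nodes has two children and is labelled with an input coin $i\in[n]$ or with a constant $c\in(0,1)$, and each of whose leaves is labelled with an element of $\mathcal O$. It is executed from the root: at an internal node one flips, independently of everything before, the coin of bias $p_i$ (respectively $c$) and moves to the right child on heads and to the left child on tails; on reaching a leaf one outputs its label. A function $f:K\to[0,1]$ is implementable by a Bernoulli factory if there is a factory with outputs in $\{0,1\}$ that, for every $p\in K$,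 reaches a leaf almost surely and outputs $1$ with probability $f(p)$. A function $f:K\to[0,1]$ is polynomially bounded if there are an integer $m\ge0$ and a real $c>0$ such that, for every partition of $[n]$ into three (possibly empty) sets $A,S,B$: if $f(q)>0$ for some $q\in K$ with $q_i=0$ on $A$, $0<q_i<1$ on $S$ and $q_i=1$ on $B$, then $$f(p)\ \ge\ c\Big(\prod_{i\in A}(1-p_i)\prod_{i\in S}p_i(1-p_i)\prod_{i\in B}p_i\Big)^m\quad\text{for all }p\in K.$$ Theorem. (i) $\sum_{|V|=k}g_V(p)>0$ for every $p\in K$ that is not of the form $e_V$, so that every $\overline f_U$ is well defined on $K$. (ii) For every $U\subseteq[n]$ with $|U|=k$, the function $\overline f_U$ is continuous on $K$, both $\overline f_U$ and $1-\overline f_U$ are polynomially bounded, and $\overline f_U$ is implementable by a Bernoulli factory. (iii) There is a single factory, whose outputs are $k$-subsets of $[n]$, that for every $p\in K$ (including all boundary points, such as the vertices $e_U$) reaches a leaf almost surely and outputs a random $k$-subset $U$ with $\mathbb P_p[U=W]=\overline f_W(p)$ for every $k$-subset $W$; in particular $\mathbb P_p[i\in U]=p_i$ for every $i\in[n]$.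 -/

import Mathlib

open scoped ENNReal

/-- The label of a node of a factory that has `n` input coins and outputs in `α`: an internal node
flips either the input coin `i` (of unknown bias) or a coin of known bias `c ∈ (0,1)`; a leaf
carries an output. -/
inductive NodeLabel (n : ℕ) (α : Type) : Type
  | coin (i : Fin n) : NodeLabel n α
  | known (c : Set.Ioo (0 : ℝ) 1) : NodeLabel n α
  | leaf (a : α) : NodeLabel n α

/-- A (possibly infinite) rooted binary tree with labelled nodes. A node is addressed by the list of
flip outcomes that lead to it from the root (first flip first, `true` meaning heads, i.e. `1`).
The nodes of the tree are the addresses with no leaf strictly above them; the labels at the other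
addresses play no role (such addresses are reached with probability `0`). -/
abbrev Factory (n : ℕ) (α : Type) : Type := List Bool → NodeLabel n α

namespace Factory

variable {n : ℕ} {α : Type}

/-- The subtree hanging from the child `b` of the root. -/
def child (F : Factory n α) (b : Bool) : Factory n α := fun w => F (b :: w)

/-- Probability that a coin of bias `q` shows `b`. -/
noncomputable def flipProb (q : ℝ) (b : Bool) : ℝ≥0∞ :=
  ENNReal.ofReal (if b = true then q else 1 - q)

/-- Probability that the first flip of the execution from the root gives `b`; the execution does not
leave the root if it is a leaf. -/
noncomputable def stepProb (p : Fin n → ℝ) (F : Factory n α) (b : Bool) : ℝ≥0∞ :=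
  match F [] with
  | .coin i => flipProb (p i) b
  | .known c => flipProb (c : ℝ) b
  | .leaf _ => 0

/-- Probability that the execution of `F` with independent coins of biases `p` visits
the node `w`. -/
noncomputable def reachProb (p : Fin n → ℝ) (F : Factory n α) : List Bool → ℝ≥0∞
  | [] => 1
  | b :: w => stepProb p F b * reachProb p (F.child b) w

/-- `ℙ_p[the execution reaches a leaf and its label lies in E]`: the total probability of the
leaves with label in `E`. -/
noncomputable def outputProb (F : Factory n α) (p : Fin n → ℝ) (E : Set α) : ℝ≥0∞ :=
  ∑' w : List Bool, Set.indicator {w | ∃ a ∈ E, F w = NodeLabel.leaf a} (reachProb p F) w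

/-- With coins of biases `p`, the execution reaches a leaf almost surely. -/
def TerminatesAt (F : Factory n α) (p : Fin n → ℝ) : Prop :=
  F.outputProb p Set.univ = 1

end Factory

/-- `f` is implementable on `K` by a Bernoulli factory: some factory with outputs in `{0,1}`
terminates almost surely and outputs `1` with probability `f p`, for every `p ∈ K`. -/
def ImplementableOn {n : ℕ} (K : Set (Fin n → ℝ)) (f : (Fin n → ℝ) → ℝ) : Prop :=
  ∃ F : Factory n Bool, ∀ p ∈ K,
    F.TerminatesAt p ∧ F.outputProb p {true} = ENNReal.ofReal (f p)

/-- The open face `F_{A,S,B}` of the hypercube. -/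
def openFace {n : ℕ} (A S B : Finset (Fin n)) : Set (Fin n → ℝ) :=
  {p | (∀ i ∈ A, p i = 0) ∧ (∀ i ∈ S, 0 < p i ∧ p i < 1) ∧ (∀ i ∈ B, p i = 1)}

/-- `f` is polynomially bounded on `K ⊆ [0,1]^n`: the open faces range over the partitions of the
index set into three (possibly empty) sets `A`, `S`, `B`. -/
def PolynomiallyBoundedOn {n : ℕ} (K : Set (Fin n → ℝ)) (f : (Fin n → ℝ) → ℝ) : Prop :=
  ∃ m : ℕ, ∃ c : ℝ, 0 < c ∧ ∀ A S B : Finset (Fin n),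
    Disjoint A S → Disjoint A B → Disjoint S B → A ∪ S ∪ B = Finset.univ →
    (∃ q ∈ K ∩ openFace A S B, 0 < f q) →
    ∀ p ∈ K,
      c * ((∏ i ∈ A, (1 - p i)) * (∏ i ∈ S, p i) * (∏ i ∈ S, (1 - p i)) * ∏ i ∈ B, p i) ^ m ≤ f p

/-- `K = {p ∈ [0,1]^n : ∑ p_i = k}`. -/
def sampfordDomain (n k : ℕ) : Set (Fin n → ℝ) :=
  {p | (∀ i, 0 ≤ p i ∧ p i ≤ 1) ∧ ∑ i, p i = (k : ℝ)}

/-- The point `e_U` of the hypercube. -/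
def vertex {n : ℕ} (U : Finset (Fin n)) : Fin n → ℝ := fun i => if i ∈ U then 1 else 0

/-- The probability `g_U(p)` that a single round of Sampford sampling outputs the `k`-subset `U`:
a flip of every coin gives exactly the set `U` of heads, and then a uniformly random coin
outside `U` is flipped again and comes up heads. -/
noncomputable def sampfordRound (n k : ℕ) (U : Finset (Fin n)) (p : Fin n → ℝ) : ℝ :=
  1 / ((n : ℝ) - (k : ℝ)) * (∏ i ∈ U, p i) * (∏ i ∈ Uᶜ, (1 - p i)) * ∑ i ∈ Uᶜ, p i

/-- `∑_{|V| = k} g_V(p)`, the probability that a single round of Sampford sampling succeeds. -/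
noncomputable def sampfordTotal (n k : ℕ) (p : Fin n → ℝ) : ℝ :=
  ∑ V ∈ Finset.powersetCard k (Finset.univ : Finset (Fin n)), sampfordRound n k V p

/-- Sampford's output probability `f_U(p)` (meaningful where the denominator is positive). -/
noncomputable def sampfordProb (n k : ℕ) (U : Finset (Fin n)) (p : Fin n → ℝ) : ℝ :=
  sampfordRound n k U p / sampfordTotal n k p

open Classical in
/-- The completion of `f_U`: `1` at `e_U`, `0` at `e_V` for `V ≠ U`, and `f_U` elsewhere. -/
noncomputable def sampfordCompletion (n k : ℕ) (U : Finset (Fin n)) (p : Fin n → ℝ) : ℝ :=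
  if p = vertex U then 1
  else if ∃ V : Finset (Fin n), p = vertex V then 0
  else sampfordProb n k U p

/-!
Write `g_U` for `sampfordRound n k U`, `T` for the sum of the `g_V` over the `k`-subsets `V`, and
`h_U` for the probability `headsProb U` that one flip of every coin gives exactly the set `U` of heads.
Sampford's procedure loops forever at a vertex, because the normalisation `T` vanishes there. The
remedy is a coefficientwise lower bound: for a suitable `m`, every difference
`g_U - h_U ^ (m + 1) * T` is a polynomial in the `p i` and `1 - p i` with nonnegative coefficients
(`exists_sampfordRound_sub_mem_coinSemiring`). It gives `h_U ^ (m + 1) ≤ f_U` on the domain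
(`headsProb_pow_le_sampfordCompletion`), with equality to `1` at the vertex of `U`. This bound is
responsible for everything that concerns the boundary:

* continuity at a vertex, by squeezing;
* polynomial boundedness of `f_U`, with exponent `m + 1` and constant `1`, since the product over an
  open face on which `f_U` does not vanish is at most `h_U`. For `1 - f_U` the bound is applied to
  some `f_V` with `V ≠ U`;
* the factory (`exists_factory_sampfordCompletion`): flip all coins `m + 1` times and output `U` if
  all rounds show the same `k`-subset `U` of heads. This has probability `h_U ^ (m + 1)`, hence it
  happens almost surely at the vertex of `U`. Otherwise repeat a trial whose output is `U` with
  probability proportional to `g_U - h_U ^ (m + 1) * T`. The sum of these weights is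
  `(1 - ∑ h_V ^ (m + 1)) * T`, so `U` is output with total probability `g_U / T`.

The factories are assembled from single flips by sequential composition (`Factory.bind`) and by
repetition until success (`Factory.loop`), whose output probabilities are computed in
`Factory.expect_bind` and `Factory.expect_loop`. The inclusion probabilities follow from an exchange
identity (`sum_sampfordRound_exchange`).
-/

/-! ### Output distributions and composition of factories -/

namespace Factory

variable {n : ℕ} {α β : Type}

/-- The weight that `φ` puts on a node: `φ a` at a leaf with output `a`, zero at internal nodes. -/
def leafValue (φ : α → ℝ≥0∞) : NodeLabel n α → ℝ≥0∞
  | .leaf a => φ a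
  | _ => 0

/-- The expectation of `φ` of the output; executions that never reach a leaf contribute zero. -/
noncomputable def expect (F : Factory n α) (p : Fin n → ℝ) (φ : α → ℝ≥0∞) : ℝ≥0∞ :=
  ∑' w : List Bool, leafValue φ (F w) * reachProb p F w

/-- The part of `expect F p φ` coming from the leaves at depth less than `N`. -/
noncomputable def expectWithin (F : Factory n α) (p : Fin n → ℝ) (φ : α → ℝ≥0∞) (N : ℕ) : ℝ≥0∞ :=
  ∑' w : List Bool, if w.length < N then leafValue φ (F w) * reachProb p F w else 0

theorem tsum_list_bool (f : List Bool → ℝ≥0∞) :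
    ∑' w, f w = f [] + ∑ b : Bool, ∑' w, f (b :: w) := by
  let e : Unit ⊕ Bool × List Bool ≃ List Bool :=
    { toFun := Sum.elim (fun _ => []) fun x => x.1 :: x.2
      invFun := fun w => match w with
        | [] => .inl ()
        | b :: w => .inr (b, w)
      left_inv := by rintro (_ | ⟨b, w⟩) <;> rfl
      right_inv := by rintro (_ | ⟨b, w⟩) <;> rfl }
  rw [← e.tsum_eq, Summable.tsum_sum ENNReal.summable ENNReal.summable, tsum_fintype,
    Fintype.sum_unique, ← tsum_fintype (L := .unconditional _) (fun b : Bool => ∑' w, f (b :: w)),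
    ← ENNReal.tsum_prod (f := fun b w => f (b :: w))]
  rfl

theorem expect_eq (F : Factory n α) (p : Fin n → ℝ) (φ : α → ℝ≥0∞) :
    F.expect p φ = leafValue φ (F []) + ∑ b : Bool, stepProb p F b * (F.child b).expect p φ := by
  rw [expect, tsum_list_bool]
  congr 1
  · simp [reachProb]
  · refine Finset.sum_congr rfl fun b _ => ?_
    rw [expect, ← ENNReal.tsum_mul_left]
    refine tsum_congr fun w => ?_
    simp only [reachProb, child]
    ring

theorem expectWithin_zero (F : Factory n α) (p : Fin n → ℝ) (φ : α → ℝ≥0∞) :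
    F.expectWithin p φ 0 = 0 := by
  simp [expectWithin]

theorem expectWithin_succ (F : Factory n α) (p : Fin n → ℝ) (φ : α → ℝ≥0∞) (N : ℕ) :
    F.expectWithin p φ (N + 1) =
      leafValue φ (F []) + ∑ b : Bool, stepProb p F b * (F.child b).expectWithin p φ N := by
  rw [expectWithin, tsum_list_bool]
  congr 1
  · simp [reachProb]
  · refine Finset.sum_congr rfl fun b _ => ?_
    rw [expectWithin, ← ENNReal.tsum_mul_left]
    refine tsum_congr fun w => ?_
    simp only [reachProb, child, List.length_cons, Nat.add_lt_add_iff_right]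
    split_ifs
    · ring
    · simp

theorem expectWithin_le (F : Factory n α) (p : Fin n → ℝ) (φ : α → ℝ≥0∞) (N : ℕ) :
    F.expectWithin p φ N ≤ F.expect p φ := by
  refine ENNReal.tsum_le_tsum fun w => ?_
  split_ifs <;> simp

theorem expect_le_of_expectWithin_le {F : Factory n α} {p : Fin n → ℝ} {φ : α → ℝ≥0∞} {B : ℝ≥0∞}
    (h : ∀ N, F.expectWithin p φ N ≤ B) : F.expect p φ ≤ B := by
  rw [expect, ENNReal.tsum_eq_iSup_sum]
  refine iSup_le fun s => ?_
  refine le_trans ?_ (h (s.sup List.length + 1))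
  refine le_trans (le_of_eq ?_) (ENNReal.sum_le_tsum s)
  refine Finset.sum_congr rfl fun w hw => ?_
  rw [if_pos (Nat.lt_succ_of_le (Finset.le_sup (f := List.length) hw))]

theorem stepProb_of_leaf {F : Factory n α} {a : α} (h : F [] = .leaf a) (p : Fin n → ℝ) (b : Bool) :
    stepProb p F b = 0 := by
  simp [stepProb, h]

theorem expect_of_leaf {F : Factory n α} {a : α} (h : F [] = .leaf a) (p : Fin n → ℝ)
    (φ : α → ℝ≥0∞) : F.expect p φ = φ a := by
  rw [expect_eq]
  simp [stepProb_of_leaf h, h, leafValue]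

theorem sum_flipProb {q : ℝ} (h0 : 0 ≤ q) (h1 : q ≤ 1) : ∑ b : Bool, flipProb q b = 1 := by
  simp only [flipProb, Fintype.sum_bool, if_true, Bool.false_eq_true, if_false]
  rw [← ENNReal.ofReal_add h0 (by linarith)]
  simp

theorem expect_const_one_le {p : Fin n → ℝ} (hp : ∀ i, 0 ≤ p i ∧ p i ≤ 1) (F : Factory n α) :
    F.expect p (fun _ => 1) ≤ 1 := by
  refine expect_le_of_expectWithin_le fun N => ?_
  induction N generalizing F with
  | zero => simp [expectWithin_zero]
  | succ N ih =>
    have key : leafValue (fun _ => 1) (F []) + ∑ b : Bool, stepProb p F b ≤ 1 := by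
      rcases h : F [] with i | c | a
      · have := sum_flipProb (hp i).1 (hp i).2
        simp only [leafValue, stepProb, h, zero_add, this, le_refl]
      · have := sum_flipProb c.2.1.le c.2.2.le
        simp only [leafValue, stepProb, h, zero_add, this, le_refl]
      · simp [leafValue, stepProb, h]
    rw [expectWithin_succ]
    refine le_trans ?_ key
    gcongr with b
    exact mul_le_of_le_one_right' (ih _)

/-- Run `F`; if it outputs `a`, go on with `G a`. -/
def bind (F : Factory n α) (G : α → Factory n β) : Factory n β
  | [] => match F [] with
    | .coin i => .coin i
    | .known c => .known c
    | .leaf a => G a []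
  | b :: w => match F [] with
    | .leaf a => G a (b :: w)
    | _ => bind (F.child b) G w

theorem bind_of_leaf {F : Factory n α} {a : α} (h : F [] = .leaf a) (G : α → Factory n β) :
    F.bind G = G a := by
  funext w
  cases w <;> simp [bind, h]

theorem child_bind {F : Factory n α} (h : ∀ a, F [] ≠ .leaf a) (G : α → Factory n β) (b : Bool) :
    (F.bind G).child b = (F.child b).bind G := by
  funext w
  rcases hF : F [] with i | c | a
  · simp [child, bind, hF]
  · simp [child, bind, hF]
  · exact absurd hF (h a)

theorem stepProb_bind {F : Factory n α} (h : ∀ a, F [] ≠ .leaf a) (G : α → Factory n β)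
    (p : Fin n → ℝ) (b : Bool) : stepProb p (F.bind G) b = stepProb p F b := by
  rcases hF : F [] with i | c | a
  · simp [stepProb, bind, hF]
  · simp [stepProb, bind, hF]
  · exact absurd hF (h a)

theorem leafValue_of_not_leaf {l : NodeLabel n α} (h : ∀ a, l ≠ .leaf a) (φ : α → ℝ≥0∞) :
    leafValue φ l = 0 := by
  rcases l with i | c | a
  · rfl
  · rfl
  · exact absurd rfl (h a)

theorem leafValue_bind {F : Factory n α} (h : ∀ a, F [] ≠ .leaf a) (G : α → Factory n β)
    (φ : β → ℝ≥0∞) : leafValue φ (F.bind G []) = 0 := by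
  rcases hF : F [] with i | c | a
  · simp [leafValue, bind, hF]
  · simp [leafValue, bind, hF]
  · exact absurd hF (h a)

/-- The law of total expectation for running one factory after another. -/
theorem expect_bind (F : Factory n α) (G : α → Factory n β) (p : Fin n → ℝ) (φ : β → ℝ≥0∞) :
    (F.bind G).expect p φ = F.expect p fun a => (G a).expect p φ := by
  apply le_antisymm
  · refine expect_le_of_expectWithin_le fun N => ?_
    induction N generalizing F with
    | zero => simp [expectWithin_zero]
    | succ N ih =>
      by_cases h : ∃ a, F [] = .leaf a
      · obtain ⟨a, h⟩ := h
        rw [bind_of_leaf h, expect_of_leaf h]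
        exact expectWithin_le _ _ _ _
      · push Not at h
        rw [expectWithin_succ, expect_eq, leafValue_bind h, leafValue_of_not_leaf h]
        simp only [stepProb_bind h, child_bind h]
        gcongr with b
        exact ih _
  · refine expect_le_of_expectWithin_le fun N => ?_
    induction N generalizing F with
    | zero => simp [expectWithin_zero]
    | succ N ih =>
      by_cases h : ∃ a, F [] = .leaf a
      · obtain ⟨a, h⟩ := h
        rw [bind_of_leaf h]
        exact (expectWithin_le _ _ _ _).trans (expect_of_leaf h p _).le
      · push Not at h
        rw [expectWithin_succ, expect_eq (F.bind G), leafValue_bind h, leafValue_of_not_leaf h]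
        simp only [stepProb_bind h, child_bind h]
        gcongr with b
        exact ih _

/-- The factory that outputs `a` without flipping a coin. -/
def pure (a : α) : Factory n α := fun _ => .leaf a

theorem expect_pure (a : α) (p : Fin n → ℝ) (φ : α → ℝ≥0∞) :
    (pure a : Factory n α).expect p φ = φ a :=
  expect_of_leaf (F := pure a) rfl p φ

/-- The factory that makes the flip described by the label `l` and outputs the result. -/
def flip (l : NodeLabel n Bool) : Factory n Bool
  | [] => l
  | b :: _ => .leaf b

theorem expect_flip {l : NodeLabel n Bool} (h : ∀ a, l ≠ .leaf a) (p : Fin n → ℝ)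
    (φ : Bool → ℝ≥0∞) : (flip l).expect p φ = ∑ b : Bool, stepProb p (flip l) b * φ b := by
  rw [expect_eq, show flip l [] = l from rfl, leafValue_of_not_leaf h, zero_add]
  refine Finset.sum_congr rfl fun b _ => ?_
  rw [show (flip l).child b = pure b from rfl, expect_pure]

/-- A coin of bias `1 / 2`. -/
noncomputable def half : Set.Ioo (0 : ℝ) 1 := ⟨1 / 2, by norm_num, by norm_num⟩

/-- The state of `loop F` in the middle of a round: `H` is the subtree of `F` that is being executed.
A round that fails flips a fair coin, ignores the result and restarts `F`. This idle flip makes the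
recursion well founded also when `F` fails without flipping a coin. -/
noncomputable def loopFrom (F : Factory n (Option α)) (H : Factory n (Option α)) : Factory n α
  | [] => match H [] with
    | .coin i => .coin i
    | .known c => .known c
    | .leaf none => .known half
    | .leaf (some a) => .leaf a
  | b :: w => match H [] with
    | .leaf none => loopFrom F F w
    | .leaf (some a) => .leaf a
    | _ => loopFrom F (H.child b) w

/-- Repeat `F` until it succeeds, that is, until its output is of the form `some a`. -/
noncomputable def loop (F : Factory n (Option α)) : Factory n α := loopFrom F F

/-- What `loop F` does after a round: output the result, or restart after an idle flip. -/
noncomputable def loopNext (F : Factory n (Option α)) : Option α → Factory n α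
  | none => (flip (.known half)).bind fun _ => loop F
  | some a => pure a

theorem loopFrom_eq_bind (F H : Factory n (Option α)) : loopFrom F H = H.bind (loopNext F) := by
  funext w
  induction w generalizing H with
  | nil => rcases h : H [] with i | c | (_ | a) <;> simp [loopFrom, bind, h, loopNext, flip, pure]
  | cons b w ih =>
    rcases h : H [] with i | c | (_ | a)
    · simp [loopFrom, bind, h, ih]
    · simp [loopFrom, bind, h, ih]
    · have : (flip (.known half) : Factory n Bool).child b = pure b := rfl
      simp only [loopFrom, bind, h, loopNext, flip, this]
      rw [bind_of_leaf (a := b) rfl]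
      rfl
    · simp [loopFrom, bind, h, loopNext, pure]

theorem expect_loop (F : Factory n (Option α)) (p : Fin n → ℝ) (φ : α → ℝ≥0∞) :
    F.loop.expect p φ = F.expect p fun o => o.elim (F.loop.expect p φ) φ := by
  conv_lhs => rw [loop, loopFrom_eq_bind, expect_bind]
  congr 1
  funext o
  rcases o with _ | a
  · have hl : ∀ a : Bool, (NodeLabel.known half : NodeLabel n Bool) ≠ .leaf a := by simp
    have := sum_flipProb half.2.1.le half.2.2.le
    rw [loopNext, expect_bind, expect_flip hl, ← Finset.sum_mul]
    simp only [stepProb, flip, this, one_mul, Option.elim]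
  · rw [loopNext, expect_pure]
    rfl

theorem outputProb_eq_expect (F : Factory n α) (p : Fin n → ℝ) (E : Set α) :
    F.outputProb p E = F.expect p (E.indicator 1) := by
  classical
  refine tsum_congr fun w => ?_
  rcases h : F w with i | c | a
  · simp [leafValue, h]
  · simp [leafValue, h]
  · by_cases ha : a ∈ E <;> simp [leafValue, h, ha]

theorem expect_eq_sum [Fintype α] (F : Factory n α) (p : Fin n → ℝ) (φ : α → ℝ≥0∞) :
    F.expect p φ = ∑ a, F.outputProb p {a} * φ a := by
  classical
  simp only [outputProb_eq_expect, expect, ← ENNReal.tsum_mul_right]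
  rw [← Summable.tsum_finsetSum fun _ _ => ENNReal.summable]
  refine tsum_congr fun w => ?_
  rcases h : F w with i | c | a
  · simp [leafValue]
  · simp [leafValue]
  · simp only [leafValue]
    rw [Finset.sum_eq_single a]
    · simp [mul_comm]
    · intro b _ hb
      simp [hb.symm]
    · simp

theorem outputProb_eq_sum [Fintype α] (F : Factory n α) (p : Fin n → ℝ) (E : Set α)
    [DecidablePred (· ∈ E)] :
    F.outputProb p E = ∑ a, if a ∈ E then F.outputProb p {a} else 0 := by
  rw [outputProb_eq_expect, expect_eq_sum]
  refine Finset.sum_congr rfl fun a _ => ?_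
  by_cases ha : a ∈ E <;> simp [ha]

theorem outputProb_le_one {p : Fin n → ℝ} (hp : ∀ i, 0 ≤ p i ∧ p i ≤ 1) (F : Factory n α)
    (E : Set α) : F.outputProb p E ≤ 1 := by
  rw [outputProb_eq_expect]
  refine le_trans (ENNReal.tsum_le_tsum fun w => ?_) (expect_const_one_le hp F)
  gcongr
  rcases F w with i | c | a
  · exact le_rfl
  · exact le_rfl
  · exact Set.indicator_le_self' (by simp) a

end Factory

/-! ### Polynomials that can be simulated -/

/-- The hypercube of all possible vectors of coin biases. -/
def biasCube (n : ℕ) : Set (Fin n → ℝ) := {p | ∀ i, 0 ≤ p i ∧ p i ≤ 1}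

namespace Factory

variable {n : ℕ} {α β : Type}

/-- For all coin biases `p`, the factory `F` terminates almost surely and outputs `a` with
probability `q a p`. -/
structure Samples [Fintype α] (F : Factory n α) (q : α → (Fin n → ℝ) → ℝ) : Prop where
  nonneg : ∀ p ∈ biasCube n, ∀ a, 0 ≤ q a p
  sum_eq_one : ∀ p ∈ biasCube n, ∑ a, q a p = 1
  outputProb_eq : ∀ p ∈ biasCube n, ∀ a, F.outputProb p {a} = ENNReal.ofReal (q a p)

theorem samples_pure [Fintype α] [DecidableEq α] (a : α) :
    Samples (pure a : Factory n α) fun b _ => if b = a then 1 else 0 where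
  nonneg p _ b := by positivity
  sum_eq_one p _ := by simp
  outputProb_eq p _ b := by
    rw [outputProb_eq_expect, expect_pure]
    by_cases h : a = b
    · simp [h]
    · simp [h, Ne.symm h]

theorem Samples.bind [Fintype α] [Fintype β] {F : Factory n α} {G : α → Factory n β}
    {q : α → (Fin n → ℝ) → ℝ} {r : α → β → (Fin n → ℝ) → ℝ} (hF : Samples F q)
    (hG : ∀ a, Samples (G a) (r a)) :
    Samples (F.bind G) fun b p => ∑ a, q a p * r a b p where
  nonneg p hp b := Finset.sum_nonneg fun a _ => mul_nonneg (hF.nonneg p hp a) ((hG a).nonneg p hp b)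
  sum_eq_one p hp := by
    rw [Finset.sum_comm]
    simp only [← Finset.mul_sum, (hG _).sum_eq_one p hp, mul_one, hF.sum_eq_one p hp]
  outputProb_eq p hp b := by
    rw [outputProb_eq_expect, expect_bind, expect_eq_sum, ENNReal.ofReal_sum_of_nonneg fun a _ =>
      mul_nonneg (hF.nonneg p hp a) ((hG a).nonneg p hp b)]
    refine Finset.sum_congr rfl fun a _ => ?_
    rw [← outputProb_eq_expect, hF.outputProb_eq p hp, (hG a).outputProb_eq p hp,
      ENNReal.ofReal_mul (hF.nonneg p hp a)]

theorem Samples.congr [Fintype α] {F : Factory n α} {q r : α → (Fin n → ℝ) → ℝ} (h : Samples F q)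
    (e : ∀ a p, q a p = r a p) : Samples F r := by
  have : q = r := by
    funext a p
    exact e a p
  exact this ▸ h

/-- There is a factory that outputs `true` with probability `q p` and `false` with probability
`1 - q p`, for all coin biases `p`. -/
def Simulable (q : (Fin n → ℝ) → ℝ) : Prop :=
  ∃ F : Factory n Bool, Samples F fun b => cond b q (1 - q)

theorem simulable_flip {l : NodeLabel n Bool} {q : (Fin n → ℝ) → ℝ} (hl : ∀ a, l ≠ .leaf a)
    (hq : ∀ p ∈ biasCube n, 0 ≤ q p ∧ q p ≤ 1)
    (h : ∀ p b, stepProb p (flip l) b = flipProb (q p) b) : Simulable q := by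
  refine ⟨flip l, fun p hp b => ?_, fun p _ => by simp, fun p _ b => ?_⟩
  · have := hq p hp
    cases b <;> simp [this]
  · rw [outputProb_eq_expect, expect_flip hl]
    cases b <;> simp [h, flipProb]

theorem simulable_coord (i : Fin n) : Simulable fun p : Fin n → ℝ => p i :=
  simulable_flip (l := .coin i) (by simp) (fun _ hp => hp i) fun p b => by simp [stepProb, flip]

theorem simulable_zero : Simulable (0 : (Fin n → ℝ) → ℝ) :=
  ⟨_, (samples_pure false).congr fun a p => by cases a <;> simp⟩

theorem simulable_one : Simulable (1 : (Fin n → ℝ) → ℝ) :=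
  ⟨_, (samples_pure true).congr fun a p => by cases a <;> simp⟩

theorem simulable_const {c : ℝ} (h0 : 0 ≤ c) (h1 : c ≤ 1) : Simulable fun _ : Fin n → ℝ => c := by
  rcases h0.eq_or_lt with rfl | h0
  · exact simulable_zero
  rcases h1.eq_or_lt with rfl | h1
  · exact simulable_one
  exact simulable_flip (l := .known ⟨c, h0, h1⟩) (by simp) (fun _ _ => ⟨h0.le, h1.le⟩)
    fun p b => by simp [stepProb, flip]

theorem Simulable.exists_samples_ite [Fintype α] {q : (Fin n → ℝ) → ℝ}
    {a b : α → (Fin n → ℝ) → ℝ} {A B : Factory n α} (hq : Simulable q) (hA : Samples A a)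
    (hB : Samples B b) :
    ∃ F : Factory n α, Samples F fun x p => q p * a x p + (1 - q p) * b x p := by
  obtain ⟨Q, hQ⟩ := hq
  refine ⟨_, (hQ.bind (G := fun x => cond x A B) (r := fun x => cond x a b)
    (by rintro (_ | _) <;> assumption)).congr fun x p => ?_⟩
  simp

theorem Simulable.ite {q a b : (Fin n → ℝ) → ℝ} (hq : Simulable q) (ha : Simulable a)
    (hb : Simulable b) : Simulable (q * a + (1 - q) * b) := by
  obtain ⟨A, hA⟩ := ha
  obtain ⟨B, hB⟩ := hb
  obtain ⟨F, hF⟩ := hq.exists_samples_ite hA hB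
  refine ⟨F, hF.congr fun x p => ?_⟩
  cases x <;> simp
  ring

theorem Simulable.mul {q a : (Fin n → ℝ) → ℝ} (hq : Simulable q) (ha : Simulable a) :
    Simulable (q * a) := by
  simpa using hq.ite ha simulable_zero

theorem Simulable.one_sub {q : (Fin n → ℝ) → ℝ} (hq : Simulable q) : Simulable (1 - q) := by
  simpa using hq.ite simulable_zero simulable_one

theorem Simulable.pow {q : (Fin n → ℝ) → ℝ} (hq : Simulable q) (m : ℕ) : Simulable (q ^ m) := by
  induction m with
  | zero => simpa using simulable_one
  | succ m ih => simpa [pow_succ] using ih.mul hq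

end Factory

/-- The functions of the coin biases that are polynomials with nonnegative coefficients in the
variables `p i` and `1 - p i`. -/
noncomputable def coinSemiring (n : ℕ) : Subsemiring ((Fin n → ℝ) → ℝ) :=
  Subsemiring.closure ({q | ∃ i, q = fun p => p i} ∪ {q | ∃ i, q = fun p => 1 - p i} ∪
    {q | ∃ c : ℝ, 0 ≤ c ∧ q = fun _ => c})

section CoinSemiring

variable {n : ℕ}

theorem coord_mem_coinSemiring (i : Fin n) : (fun p => p i) ∈ coinSemiring n :=
  Subsemiring.subset_closure (.inl (.inl ⟨i, rfl⟩))

theorem one_sub_coord_mem_coinSemiring (i : Fin n) : (fun p => 1 - p i) ∈ coinSemiring n :=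
  Subsemiring.subset_closure (.inl (.inr ⟨i, rfl⟩))

theorem const_mem_coinSemiring {c : ℝ} (hc : 0 ≤ c) : (fun _ => c) ∈ coinSemiring n :=
  Subsemiring.subset_closure (.inr ⟨c, hc, rfl⟩)

theorem nonneg_of_mem_coinSemiring {q : (Fin n → ℝ) → ℝ} (hq : q ∈ coinSemiring n)
    {p : Fin n → ℝ} (hp : p ∈ biasCube n) : 0 ≤ q p := by
  induction hq using Subsemiring.closure_induction with
  | mem q hq =>
    rcases hq with (⟨i, rfl⟩ | ⟨i, rfl⟩) | ⟨c, hc, rfl⟩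
    · exact (hp i).1
    · exact sub_nonneg.2 (hp i).2
    · exact hc
  | zero => simp
  | one => simp
  | add x y _ _ hx hy => exact add_nonneg hx hy
  | mul x y _ _ hx hy => exact mul_nonneg hx hy

/-- Every element of the semiring becomes, after subtraction from a large constant, an element of the
semiring again. -/
theorem exists_const_sub_mem_coinSemiring {q : (Fin n → ℝ) → ℝ} (hq : q ∈ coinSemiring n) :
    ∃ M : ℝ, 0 ≤ M ∧ (fun _ => M) - q ∈ coinSemiring n := by
  induction hq using Subsemiring.closure_induction with
  | mem q hq =>
    rcases hq with (⟨i, rfl⟩ | ⟨i, rfl⟩) | ⟨c, hc, rfl⟩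
    · exact ⟨1, zero_le_one, one_sub_coord_mem_coinSemiring i⟩
    · refine ⟨1, zero_le_one, ?_⟩
      convert coord_mem_coinSemiring i using 1
      funext p
      simp
    · exact ⟨c, hc, by simp⟩
  | zero =>
    refine ⟨0, le_rfl, ?_⟩
    rw [sub_zero]
    exact zero_mem _
  | one =>
    refine ⟨1, zero_le_one, ?_⟩
    rw [show (fun _ => (1 : ℝ)) - 1 = (0 : (Fin n → ℝ) → ℝ) from sub_self _]
    exact zero_mem _
  | add x y _ _ hx hy =>
    obtain ⟨M, hM, hx⟩ := hx
    obtain ⟨N, hN, hy⟩ := hy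
    refine ⟨M + N, add_nonneg hM hN, ?_⟩
    convert add_mem hx hy using 1
    funext p
    simp only [Pi.sub_apply, Pi.add_apply]
    ring
  | mul x y hx' hy' hx hy =>
    obtain ⟨M, hM, hx⟩ := hx
    obtain ⟨N, hN, hy⟩ := hy
    refine ⟨M * N, mul_nonneg hM hN, ?_⟩
    convert add_mem (mul_mem (const_mem_coinSemiring hM) hy) (mul_mem hx hy') using 1
    funext p
    simp only [Pi.sub_apply, Pi.add_apply, Pi.mul_apply]
    ring

namespace Factory

variable {α : Type}

theorem exists_simulable_const_mul {q : (Fin n → ℝ) → ℝ} (hq : q ∈ coinSemiring n) :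
    ∃ c : ℝ, 0 < c ∧ c ≤ 1 ∧ Simulable fun p => c * q p := by
  induction hq using Subsemiring.closure_induction with
  | mem q hq =>
    rcases hq with (⟨i, rfl⟩ | ⟨i, rfl⟩) | ⟨c, hc, rfl⟩
    · exact ⟨1, one_pos, le_rfl, by simpa using simulable_coord i⟩
    · exact ⟨1, one_pos, le_rfl, by simpa using! (simulable_coord i).one_sub⟩
    · have h : 0 < 1 + c := by linarith
      refine ⟨(1 + c)⁻¹, by positivity, inv_le_one_of_one_le₀ (by linarith),
        simulable_const (by positivity) ?_⟩
      rw [inv_mul_le_one₀ h]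
      linarith
  | zero => exact ⟨1, one_pos, le_rfl, by simpa using! simulable_zero⟩
  | one => exact ⟨1, one_pos, le_rfl, by simpa using! simulable_one⟩
  | add x y _ _ hx hy =>
    obtain ⟨c, hc, hc1, hx⟩ := hx
    obtain ⟨d, hd, hd1, hy⟩ := hy
    refine ⟨1 / 2 * (c * d), by positivity, by nlinarith, ?_⟩
    convert (simulable_const (n := n) (c := 1 / 2) (by norm_num) (by norm_num)).ite
      ((simulable_const hd.le hd1).mul hx) ((simulable_const hc.le hc1).mul hy) using 1
    funext p
    simp only [Pi.sub_apply, Pi.add_apply, Pi.mul_apply, Pi.one_apply]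
    ring
  | mul x y _ _ hx hy =>
    obtain ⟨c, hc, hc1, hx⟩ := hx
    obtain ⟨d, hd, hd1, hy⟩ := hy
    refine ⟨c * d, by positivity, by nlinarith, ?_⟩
    convert hx.mul hy using 1
    funext p
    simp only [Pi.mul_apply]
    ring

/-- A family of elements of the semiring can be sampled in proportion by a trial that may fail: a
fair coin decides whether to try one more member of the family or the ones treated before, and both
alternatives are slowed down to a common rate. -/
theorem exists_samples_const_mul [Fintype α] [DecidableEq α] {N : α → (Fin n → ℝ) → ℝ}
    (hN : ∀ a, N a ∈ coinSemiring n) (s : Finset α) :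
    ∃ c : ℝ, 0 < c ∧ c ≤ 1 ∧ ∃ F : Factory n (Option α), Samples F fun o p =>
      o.elim (1 - c * ∑ a ∈ s, N a p) fun a => if a ∈ s then c * N a p else 0 := by
  induction s using Finset.induction_on with
  | empty =>
    refine ⟨1, one_pos, le_rfl, pure none, (samples_pure none).congr fun o p => ?_⟩
    rcases o with _ | a <;> simp
  | insert a s has ih =>
    obtain ⟨c, hc, hc1, F, hF⟩ := ih
    obtain ⟨d, hd, hd1, hG⟩ := exists_simulable_const_mul (hN a)
    refine ⟨1 / 2 * (c * d), by positivity, by nlinarith, ?_⟩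
    obtain ⟨A, hA⟩ := ((simulable_const hc.le hc1).mul hG).exists_samples_ite
      (samples_pure (some a)) (samples_pure none)
    obtain ⟨B, hB⟩ := (simulable_const hd.le hd1).exists_samples_ite hF (samples_pure none)
    obtain ⟨C, hC⟩ := (simulable_const (n := n) (c := 1 / 2) (by norm_num)
      (by norm_num)).exists_samples_ite hA hB
    refine ⟨C, hC.congr ?_⟩
    rintro (_ | b) p
    · simp [Finset.sum_insert has]
      ring
    · by_cases hb : b = a
      · subst hb
        simp [has]
        ring
      · by_cases hbs : b ∈ s
        · simp [hb, hbs]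
          ring
        · simp [hb, hbs]

end Factory

end CoinSemiring

/-! ### The coefficientwise lower bound -/

section LowerBound

variable {n : ℕ}

/-- The probability that coin `i` shows the side prescribed by `U`: heads if `i ∈ U`, tails
otherwise. -/
def sideProb (U : Finset (Fin n)) (i : Fin n) : (Fin n → ℝ) → ℝ :=
  fun p => if i ∈ U then p i else 1 - p i

/-- The probability that a flip of every coin gives exactly the set `U` of heads. -/
noncomputable def headsProb (U : Finset (Fin n)) : (Fin n → ℝ) → ℝ := ∏ i, sideProb U i

theorem headsProb_apply (U : Finset (Fin n)) (p : Fin n → ℝ) :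
    headsProb U p = (∏ i ∈ U, p i) * ∏ i ∈ Uᶜ, (1 - p i) := by
  rw [headsProb, Finset.prod_apply, ← Finset.prod_mul_prod_compl U]
  congr 1
  · exact Finset.prod_congr rfl fun i hi => by simp [sideProb, hi]
  · exact Finset.prod_congr rfl fun i hi => by simp [sideProb, Finset.mem_compl.1 hi]

theorem sampfordRound_apply (k : ℕ) (U : Finset (Fin n)) (p : Fin n → ℝ) :
    sampfordRound n k U p = 1 / ((n : ℝ) - k) * headsProb U p * ∑ i ∈ Uᶜ, p i := by
  rw [sampfordRound, headsProb_apply]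
  ring

theorem sampfordTotal_eq (k : ℕ) :
    sampfordTotal n k = ∑ V ∈ Finset.powersetCard k Finset.univ, sampfordRound n k V := by
  funext p
  rw [sampfordTotal, Finset.sum_apply]

theorem sideProb_of_mem {U : Finset (Fin n)} {i : Fin n} (h : i ∈ U) :
    sideProb U i = fun p => p i := by
  funext p
  simp [sideProb, h]

theorem sideProb_of_notMem {U : Finset (Fin n)} {i : Fin n} (h : i ∉ U) :
    sideProb U i = fun p => 1 - p i := by
  funext p
  simp [sideProb, h]

theorem sideProb_mem_coinSemiring (U : Finset (Fin n)) (i : Fin n) :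
    sideProb U i ∈ coinSemiring n := by
  by_cases h : i ∈ U
  · exact sideProb_of_mem h ▸ coord_mem_coinSemiring i
  · exact sideProb_of_notMem h ▸ one_sub_coord_mem_coinSemiring i

theorem one_sub_sideProb_mem_coinSemiring (U : Finset (Fin n)) (i : Fin n) :
    1 - sideProb U i ∈ coinSemiring n := by
  by_cases h : i ∈ U
  · exact sideProb_of_mem h ▸ one_sub_coord_mem_coinSemiring i
  · rw [sideProb_of_notMem h]
    convert coord_mem_coinSemiring i using 1
    funext p
    simp

theorem one_sub_prod_sideProb_mem_coinSemiring (U s : Finset (Fin n)) :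
    1 - ∏ i ∈ s, sideProb U i ∈ coinSemiring n := by
  induction s using Finset.induction_on with
  | empty => simp
  | insert i s hi ih =>
    rw [Finset.prod_insert hi]
    convert add_mem (one_sub_sideProb_mem_coinSemiring U i)
      (mul_mem (sideProb_mem_coinSemiring U i) ih) using 1
    ring

theorem headsProb_mem_coinSemiring (U : Finset (Fin n)) : headsProb U ∈ coinSemiring n :=
  prod_mem fun i _ => sideProb_mem_coinSemiring U i

theorem one_sub_headsProb_mem_coinSemiring (U : Finset (Fin n)) :
    1 - headsProb U ∈ coinSemiring n :=
  one_sub_prod_sideProb_mem_coinSemiring U Finset.univ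

theorem one_sub_headsProb_pow_mem_coinSemiring (U : Finset (Fin n)) (m : ℕ) :
    1 - headsProb U ^ m ∈ coinSemiring n := by
  rw [← mul_neg_geom_sum]
  exact mul_mem (one_sub_headsProb_mem_coinSemiring U)
    (sum_mem fun l _ => pow_mem (headsProb_mem_coinSemiring U) l)

/-- The sum of the biases of the coins outside `U`. -/
noncomputable def outsideSum (U : Finset (Fin n)) : (Fin n → ℝ) → ℝ := ∑ i ∈ Uᶜ, fun p => p i

theorem outsideSum_mem_coinSemiring (U : Finset (Fin n)) : outsideSum U ∈ coinSemiring n :=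
  sum_mem fun i _ => coord_mem_coinSemiring i

theorem sampfordRound_eq (k : ℕ) (U : Finset (Fin n)) :
    sampfordRound n k U = (fun _ => 1 / ((n : ℝ) - k)) * headsProb U * outsideSum U := by
  funext p
  rw [sampfordRound_apply]
  simp [outsideSum]

theorem sampfordRound_mem_coinSemiring {k : ℕ} (hkn : k < n) (U : Finset (Fin n)) :
    sampfordRound n k U ∈ coinSemiring n := by
  have : (0 : ℝ) < n - k := sub_pos.2 (by exact_mod_cast hkn)
  rw [sampfordRound_eq]
  exact mul_mem (mul_mem (const_mem_coinSemiring (by positivity)) (headsProb_mem_coinSemiring U))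
    (outsideSum_mem_coinSemiring U)

/-- For `W ≠ U`, a round that outputs `W` sees a coin `j ∈ W \ U` show heads and a coin `i ∈ U \ W`
show tails. The first event is accounted for by `outsideSum U`, the second by `1 - headsProb U`. -/
theorem exists_sub_sampfordRound_mem_coinSemiring {k : ℕ} (hkn : k < n) {U W : Finset (Fin n)}
    (hc : U.card = W.card) (hne : W ≠ U) :
    ∃ M : ℝ, (fun _ => M) * outsideSum U * (1 - headsProb U) - sampfordRound n k W ∈
      coinSemiring n := by
  have hd : (0 : ℝ) < n - k := sub_pos.2 (by exact_mod_cast hkn)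
  obtain ⟨j, hjW, hjU⟩ := Finset.not_subset.1 fun h => hne (Finset.eq_of_subset_of_card_le h hc.le)
  obtain ⟨i, hiU, hiW⟩ :=
    Finset.not_subset.1 fun h => hne (Finset.eq_of_subset_of_card_le h hc.ge).symm
  have hij : i ≠ j := fun h => hjU (h ▸ hiU)
  have hi : i ∈ Finset.univ.erase j := Finset.mem_erase.2 ⟨hij, Finset.mem_univ i⟩
  have hW : headsProb W = (fun p => p j) *
      ((fun p => 1 - p i) * ∏ l ∈ (Finset.univ.erase j).erase i, sideProb W l) := by
    rw [headsProb, ← Finset.mul_prod_erase _ _ (Finset.mem_univ j), ← Finset.mul_prod_erase _ _ hi,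
      sideProb_of_mem hjW, sideProb_of_notMem hiW]
  have hU : headsProb U = (fun p => p i) * ∏ l ∈ Finset.univ.erase i, sideProb U l := by
    rw [headsProb, ← Finset.mul_prod_erase _ _ (Finset.mem_univ i), sideProb_of_mem hiU]
  have he : outsideSum U = (fun p => p j) + ∑ l ∈ Uᶜ.erase j, fun p => p l := by
    rw [outsideSum, ← Finset.add_sum_erase _ _ (Finset.mem_compl.2 hjU)]
  have hR : (fun _ => 1 / ((n : ℝ) - k)) * (∏ l ∈ (Finset.univ.erase j).erase i, sideProb W l) *
      outsideSum W ∈ coinSemiring n :=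
    mul_mem (mul_mem (const_mem_coinSemiring (by positivity))
      (prod_mem fun l _ => sideProb_mem_coinSemiring W l)) (outsideSum_mem_coinSemiring W)
  obtain ⟨M, hM, hMR⟩ := exists_const_sub_mem_coinSemiring hR
  refine ⟨M, ?_⟩
  have h1 := mul_mem (mul_mem (const_mem_coinSemiring hM)
    (sum_mem fun l (_ : l ∈ Uᶜ.erase j) => coord_mem_coinSemiring l))
    (one_sub_headsProb_mem_coinSemiring U)
  have h2 := mul_mem (mul_mem (const_mem_coinSemiring hM) (coord_mem_coinSemiring j))
    (mul_mem (coord_mem_coinSemiring i)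
      (one_sub_prod_sideProb_mem_coinSemiring U (Finset.univ.erase i)))
  have h3 := mul_mem (mul_mem (coord_mem_coinSemiring j) (one_sub_coord_mem_coinSemiring i)) hMR
  convert add_mem (add_mem h1 h2) h3 using 1
  rw [sampfordRound_eq, hW, he, hU]
  have hx : (fun p : Fin n → ℝ => 1 - p i) = 1 - fun p => p i := rfl
  rw [hx]
  ring

theorem exists_sub_sampfordTotal_mem_coinSemiring {k : ℕ} (hkn : k < n) {U : Finset (Fin n)}
    (hU : U.card = k) :
    ∃ M : ℝ, (fun _ => M) * outsideSum U * (1 - headsProb U) -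
      (sampfordTotal n k - sampfordRound n k U) ∈ coinSemiring n := by
  have hUm : U ∈ Finset.powersetCard k Finset.univ := by simp [hU]
  have h : ∀ W ∈ (Finset.powersetCard k Finset.univ).erase U, ∃ M : ℝ,
      (fun _ => M) * outsideSum U * (1 - headsProb U) - sampfordRound n k W ∈ coinSemiring n := by
    intro W hW
    rw [Finset.mem_erase, Finset.mem_powersetCard_univ] at hW
    exact exists_sub_sampfordRound_mem_coinSemiring hkn (hU.trans hW.2.symm) hW.1
  choose! M hMW using h
  refine ⟨∑ W ∈ (Finset.powersetCard k Finset.univ).erase U, M W, ?_⟩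
  convert sum_mem hMW using 1
  rw [sampfordTotal_eq, ← Finset.add_sum_erase _ _ hUm, Finset.sum_sub_distrib, ← Finset.sum_mul,
    ← Finset.sum_mul, add_sub_cancel_left]
  congr 3
  funext p
  simp

/-- The inequality `headsProb U ^ (m + 1) * T ≤ g_U` for Sampford's round probabilities `g_U` with
sum `T` holds, for large `m`, coefficientwise. With `h = headsProb U` and `e = outsideSum U`, the
other outputs contribute at most `M * e * (1 - h)` to `T`, and
`M * h ^ m * (1 - h) ≤ (1 - h ^ (m + 1)) / (n - k)` once `M ≤ (m + 1) / (n - k)`. -/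
theorem sampfordRound_sub_mem_coinSemiring {k : ℕ} (hkn : k < n) {U : Finset (Fin n)} {M : ℝ}
    (hM : (fun _ => M) * outsideSum U * (1 - headsProb U) -
      (sampfordTotal n k - sampfordRound n k U) ∈ coinSemiring n) {m : ℕ}
    (hm : M ≤ 1 / ((n : ℝ) - k) * (m + 1)) :
    sampfordRound n k U - headsProb U ^ (m + 1) * sampfordTotal n k ∈ coinSemiring n := by
  have hd : (0 : ℝ) < n - k := sub_pos.2 (by exact_mod_cast hkn)
  set c : ℝ := 1 / ((n : ℝ) - k) with hc
  have hc0 : 0 ≤ c := by positivity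
  set h := headsProb U with hh
  have hS : h ∈ coinSemiring n := headsProb_mem_coinSemiring U
  have h1 : ∑ l ∈ Finset.range (m + 1), (h ^ l - h ^ m) ∈ coinSemiring n := by
    refine sum_mem fun l hl => ?_
    obtain ⟨d, rfl⟩ := Nat.exists_eq_add_of_le (Nat.lt_succ_iff.1 (Finset.mem_range.1 hl))
    convert mul_mem (pow_mem hS l) (one_sub_headsProb_pow_mem_coinSemiring U d) using 1
    ring
  have h2 := add_mem (mul_mem (const_mem_coinSemiring hc0) h1)
    (mul_mem (const_mem_coinSemiring (sub_nonneg.2 hm)) (pow_mem hS m))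
  have h3 := mul_mem (outsideSum_mem_coinSemiring U)
    (mul_mem (one_sub_headsProb_mem_coinSemiring U) h2)
  convert mul_mem hS (add_mem (mul_mem (pow_mem hS m) hM) h3) using 1
  have hg := mul_neg_geom_sum h (m + 1)
  rw [sampfordRound_eq, ← hc, ← hh, Finset.sum_sub_distrib]
  funext p
  have hgp := congrFun hg p
  simp only [Pi.sub_apply, Pi.add_apply, Pi.mul_apply, Pi.one_apply, Pi.pow_apply,
    Finset.sum_const, Finset.card_range, nsmul_eq_mul, Pi.natCast_apply] at hgp ⊢
  push_cast
  linear_combination (-(h p * outsideSum U p * c)) * hgp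

theorem exists_sampfordRound_sub_mem_coinSemiring {k : ℕ} (hkn : k < n) :
    ∃ m : ℕ, ∀ U : Finset (Fin n), U.card = k →
      sampfordRound n k U - headsProb U ^ (m + 1) * sampfordTotal n k ∈ coinSemiring n := by
  have hd : (0 : ℝ) < n - k := sub_pos.2 (by exact_mod_cast hkn)
  have h : ∀ U : Finset (Fin n), U.card = k → ∃ M : ℝ,
      (fun _ => M) * outsideSum U * (1 - headsProb U) -
        (sampfordTotal n k - sampfordRound n k U) ∈ coinSemiring n :=
    fun U hU => exists_sub_sampfordTotal_mem_coinSemiring hkn hU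
  choose! M hM using h
  obtain ⟨B, hB⟩ := (Set.finite_range M).bddAbove
  obtain ⟨m, hm⟩ := exists_nat_ge (((n : ℝ) - k) * B)
  refine ⟨m, fun U hU => sampfordRound_sub_mem_coinSemiring hkn (hM U hU) ?_⟩
  rw [one_div, inv_mul_eq_div, le_div_iff₀ hd, mul_comm]
  calc _ ≤ ((n : ℝ) - k) * B := by gcongr; exact hB ⟨U, rfl⟩
    _ ≤ m := hm
    _ ≤ m + 1 := by linarith

end LowerBound

/-! ### Sampford probabilities on the domain -/

section Domain

variable {n k : ℕ}

theorem sampfordDomain_subset_biasCube : sampfordDomain n k ⊆ biasCube n := fun _ hp => hp.1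

theorem headsProb_nonneg {p : Fin n → ℝ} (hp : p ∈ biasCube n) (U : Finset (Fin n)) :
    0 ≤ headsProb U p :=
  nonneg_of_mem_coinSemiring (headsProb_mem_coinSemiring U) hp

theorem sampfordRound_nonneg (hkn : k < n) {p : Fin n → ℝ} (hp : p ∈ biasCube n)
    (U : Finset (Fin n)) : 0 ≤ sampfordRound n k U p :=
  nonneg_of_mem_coinSemiring (sampfordRound_mem_coinSemiring hkn U) hp

/-- At a point of the domain that is not a vertex, some coin `l` has a bias strictly between `0` and
`1`. A `k`-subset that contains all coins of bias `1`, no coin of bias `0` and misses some `l` of this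
kind is output by a round with positive probability. -/
theorem sampfordTotal_pos (hkn : k < n) {p : Fin n → ℝ} (hp : p ∈ sampfordDomain n k)
    (hv : ∀ V : Finset (Fin n), p ≠ vertex V) : 0 < sampfordTotal n k p := by
  classical
  have hd : (0 : ℝ) < n - k := sub_pos.2 (by exact_mod_cast hkn)
  have hp0 := fun i => (hp.1 i).1
  have hp1 := fun i => (hp.1 i).2
  set B : Finset (Fin n) := Finset.univ.filter fun i => p i = 1 with hB
  set C : Finset (Fin n) := Finset.univ.filter fun i => 0 < p i with hC
  have hBC : B ⊆ C := fun i hi => by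
    simp only [hB, hC, Finset.mem_filter, Finset.mem_univ, true_and] at hi ⊢
    simp [hi]
  obtain ⟨l, hlC, hlB⟩ : ∃ l ∈ C, l ∉ B := by
    by_contra! h
    refine hv B (funext fun i => ?_)
    simp only [hB, hC, Finset.mem_filter, Finset.mem_univ, true_and] at h
    by_cases h1 : p i = 1
    · simp [vertex, hB, h1]
    · have h0 : p i = 0 := le_antisymm (not_lt.1 fun h0 => h1 (h i h0)) (hp0 i)
      simp [vertex, hB, h0]
  have hl0 : 0 < p l := by simpa [hC] using hlC
  have hl1 : p l < 1 := lt_of_le_of_ne (hp1 l) (by simpa [hB] using hlB)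
  have hBk : B.card ≤ k := by
    have : (B.card : ℝ) ≤ k := by
      rw [← hp.2, Finset.card_eq_sum_ones, Nat.cast_sum, Finset.sum_filter]
      refine Finset.sum_le_sum fun i _ => ?_
      split_ifs with hi
      · simp [hi]
      · exact hp0 i
    exact_mod_cast this
  have hCk : k < C.card := by
    have : (k : ℝ) < C.card := by
      rw [← hp.2, Finset.card_eq_sum_ones, Nat.cast_sum, Finset.sum_filter]
      refine Finset.sum_lt_sum (fun i _ => ?_) ⟨l, Finset.mem_univ l, ?_⟩
      · split_ifs with hi
        · simpa using hp1 i
        · exact not_lt.1 hi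
      · simpa [hl0] using hl1
    exact_mod_cast this
  obtain ⟨U, hBU, hUC, hU⟩ := Finset.exists_subsuperset_card_eq hBC hBk hCk.le
  obtain ⟨j, hjC, hjU⟩ := Finset.exists_mem_notMem_of_card_lt_card (hU.trans_lt hCk)
  refine lt_of_lt_of_le ?_ (Finset.single_le_sum
    (fun V _ => sampfordRound_nonneg hkn (sampfordDomain_subset_biasCube hp) V)
    (Finset.mem_powersetCard_univ.2 hU))
  have hC' : ∀ i ∈ C, 0 < p i := fun i hi => by simpa [hC] using hi
  have hB' : ∀ i ∈ Uᶜ, 0 < 1 - p i := fun i hi => by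
    refine sub_pos.2 (lt_of_le_of_ne (hp1 i) fun h => Finset.mem_compl.1 hi (hBU ?_))
    simpa [hB] using h
  exact mul_pos (mul_pos (mul_pos (by positivity) (Finset.prod_pos fun i hi => hC' i (hUC hi)))
    (Finset.prod_pos hB')) (Finset.sum_pos' (fun i _ => hp0 i)
      ⟨j, Finset.mem_compl.2 hjU, hC' j hjC⟩)

theorem vertex_injective : Function.Injective (vertex : Finset (Fin n) → Fin n → ℝ) := by
  intro U V h
  ext i
  have := congrFun h i
  by_cases hU : i ∈ U <;> by_cases hV : i ∈ V <;> simp_all [vertex]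

theorem card_eq_of_vertex_mem {V : Finset (Fin n)} (h : vertex V ∈ sampfordDomain n k) :
    V.card = k := by
  have := h.2
  simp only [vertex, Finset.sum_ite_mem, Finset.univ_inter, Finset.sum_const, nsmul_eq_mul,
    mul_one] at this
  exact_mod_cast this

theorem sampfordCompletion_vertex (U V : Finset (Fin n)) :
    sampfordCompletion n k U (vertex V) = if U = V then 1 else 0 := by
  by_cases h : U = V
  · simp [sampfordCompletion, h]
  · have : vertex V ≠ vertex U := fun e => h (vertex_injective e).symm
    simp [sampfordCompletion, h, this]

theorem sampfordCompletion_of_ne_vertex {p : Fin n → ℝ}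
    (hv : ∀ V : Finset (Fin n), p ≠ vertex V) (U : Finset (Fin n)) :
    sampfordCompletion n k U p = sampfordRound n k U p / sampfordTotal n k p := by
  rw [sampfordCompletion, if_neg (hv U), if_neg (by simpa using hv), sampfordProb]

theorem sum_sampfordCompletion (hkn : k < n) {p : Fin n → ℝ} (hp : p ∈ sampfordDomain n k) :
    ∑ U ∈ Finset.powersetCard k Finset.univ, sampfordCompletion n k U p = 1 := by
  by_cases h : ∃ V, p = vertex V
  · obtain ⟨V, rfl⟩ := h
    simp [sampfordCompletion_vertex, card_eq_of_vertex_mem hp]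
  · push Not at h
    simp only [sampfordCompletion_of_ne_vertex h]
    rw [← Finset.sum_div]
    exact div_self (sampfordTotal_pos hkn hp h).ne'

theorem headsProb_vertex (U V : Finset (Fin n)) :
    headsProb U (vertex V) = if U = V then 1 else 0 := by
  rw [headsProb, Finset.prod_apply]
  split_ifs with h
  · subst h
    refine Finset.prod_eq_one fun i _ => ?_
    by_cases hi : i ∈ U <;> simp [sideProb, vertex, hi]
  · obtain ⟨i, hi⟩ : ∃ i, ¬(i ∈ U ↔ i ∈ V) := by
      by_contra! h'
      exact h (Finset.ext h')
    refine Finset.prod_eq_zero (Finset.mem_univ i) ?_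
    by_cases hU : i ∈ U <;> by_cases hV : i ∈ V <;> simp_all [sideProb, vertex]

/-- The lower bound behind continuity at the vertices, polynomial boundedness and the stopping rule
of the factory. -/
theorem headsProb_pow_le_sampfordCompletion (hkn : k < n) {m : ℕ} {U : Finset (Fin n)}
    (hm : sampfordRound n k U - headsProb U ^ (m + 1) * sampfordTotal n k ∈ coinSemiring n)
    {p : Fin n → ℝ} (hp : p ∈ sampfordDomain n k) :
    headsProb U p ^ (m + 1) ≤ sampfordCompletion n k U p := by
  by_cases h : ∃ V, p = vertex V
  · obtain ⟨V, rfl⟩ := h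
    rw [headsProb_vertex, sampfordCompletion_vertex]
    split_ifs <;> simp
  · push Not at h
    rw [sampfordCompletion_of_ne_vertex h, le_div_iff₀ (sampfordTotal_pos hkn hp h)]
    exact sub_nonneg.1 (nonneg_of_mem_coinSemiring hm (sampfordDomain_subset_biasCube hp))

theorem sampfordCompletion_nonneg (hkn : k < n) {p : Fin n → ℝ} (hp : p ∈ sampfordDomain n k)
    (U : Finset (Fin n)) : 0 ≤ sampfordCompletion n k U p := by
  by_cases h : ∃ V, p = vertex V
  · obtain ⟨V, rfl⟩ := h
    rw [sampfordCompletion_vertex]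
    split_ifs <;> simp
  · push Not at h
    rw [sampfordCompletion_of_ne_vertex h]
    exact div_nonneg (sampfordRound_nonneg hkn (sampfordDomain_subset_biasCube hp) U)
      (sampfordTotal_pos hkn hp h).le

theorem sampfordCompletion_add_le_one (hkn : k < n) {p : Fin n → ℝ} (hp : p ∈ sampfordDomain n k)
    {U V : Finset (Fin n)} (hU : U.card = k) (hV : V.card = k) (hne : U ≠ V) :
    sampfordCompletion n k U p + sampfordCompletion n k V p ≤ 1 := by
  rw [← sum_sampfordCompletion hkn hp, ← Finset.sum_pair
    (f := fun U => sampfordCompletion n k U p) hne]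
  refine Finset.sum_le_sum_of_subset_of_nonneg ?_ fun W _ _ => sampfordCompletion_nonneg hkn hp W
  intro W hW
  rw [Finset.mem_insert, Finset.mem_singleton] at hW
  rcases hW with rfl | rfl <;> simpa

theorem sampfordCompletion_le_one (hkn : k < n) {p : Fin n → ℝ} (hp : p ∈ sampfordDomain n k)
    {U : Finset (Fin n)} (hU : U.card = k) : sampfordCompletion n k U p ≤ 1 := by
  rw [← sum_sampfordCompletion hkn hp]
  exact Finset.single_le_sum (f := fun U => sampfordCompletion n k U p)
    (fun V _ => sampfordCompletion_nonneg hkn hp V) (by simpa)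

theorem continuous_sideProb (U : Finset (Fin n)) (i : Fin n) : Continuous (sideProb U i) := by
  by_cases h : i ∈ U
  · rw [sideProb_of_mem h]
    fun_prop
  · rw [sideProb_of_notMem h]
    fun_prop

theorem continuous_headsProb (U : Finset (Fin n)) : Continuous (headsProb U) := by
  have : headsProb U = fun p => ∏ i, sideProb U i p := by
    funext p
    rw [headsProb, Finset.prod_apply]
  rw [this]
  exact continuous_finsetProd _ fun i _ => continuous_sideProb U i

theorem continuous_sampfordRound (U : Finset (Fin n)) : Continuous (sampfordRound n k U) := by
  unfold sampfordRound
  fun_prop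

theorem continuous_sampfordTotal : Continuous (sampfordTotal n k) := by
  unfold sampfordTotal
  exact continuous_finsetSum _ fun V _ => continuous_sampfordRound V

open Filter Topology in
theorem continuousOn_sampfordCompletion (hkn : k < n) {m : ℕ}
    (hm : ∀ U : Finset (Fin n), U.card = k →
      sampfordRound n k U - headsProb U ^ (m + 1) * sampfordTotal n k ∈ coinSemiring n)
    {U : Finset (Fin n)} (hU : U.card = k) :
    ContinuousOn (sampfordCompletion n k U) (sampfordDomain n k) := by
  intro q hq
  by_cases h : ∃ V, q = vertex V
  · obtain ⟨V, rfl⟩ := h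
    have hV := card_eq_of_vertex_mem hq
    have ht : Tendsto (fun p => headsProb V p ^ (m + 1)) (𝓝[sampfordDomain n k] vertex V)
        (𝓝 1) := by
      have := ((continuous_headsProb V).pow (m + 1)).tendsto (vertex V)
      rw [Pi.pow_apply, headsProb_vertex, if_pos rfl, one_pow] at this
      exact this.mono_left nhdsWithin_le_nhds
    have hs := fun p (hp : p ∈ sampfordDomain n k) =>
      headsProb_pow_le_sampfordCompletion hkn (hm V hV) hp
    rw [ContinuousWithinAt, sampfordCompletion_vertex]
    split_ifs with hUV
    · subst hUV
      refine tendsto_of_tendsto_of_tendsto_of_le_of_le' ht tendsto_const_nhds ?_ ?_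
      · filter_upwards [self_mem_nhdsWithin] with p hp using hs p hp
      · filter_upwards [self_mem_nhdsWithin] with p hp using sampfordCompletion_le_one hkn hp hU
    · have ht' : Tendsto (fun p => 1 - headsProb V p ^ (m + 1))
          (𝓝[sampfordDomain n k] vertex V) (𝓝 0) := by
        simpa using ht.const_sub 1
      refine tendsto_of_tendsto_of_tendsto_of_le_of_le' tendsto_const_nhds ht' ?_ ?_
      · filter_upwards [self_mem_nhdsWithin] with p hp using sampfordCompletion_nonneg hkn hp U
      · filter_upwards [self_mem_nhdsWithin] with p hp
        linarith [hs p hp, sampfordCompletion_add_le_one hkn hp hU hV hUV]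
  · push Not at h
    have ho : {p : Fin n → ℝ | ∀ V : Finset (Fin n), p ≠ vertex V} ∈ 𝓝 q := by
      have : {p : Fin n → ℝ | ∀ V : Finset (Fin n), p ≠ vertex V} =
          (Set.range (vertex : Finset (Fin n) → Fin n → ℝ))ᶜ := by
        ext p
        simp [eq_comm]
      rw [this]
      refine (Set.finite_range _).isClosed.isOpen_compl.mem_nhds ?_
      rintro ⟨V, hV⟩
      exact h V hV.symm
    have hc : ContinuousAt (fun p => sampfordRound n k U p / sampfordTotal n k p) q :=
      (continuous_sampfordRound U).continuousAt.div continuous_sampfordTotal.continuousAt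
        (sampfordTotal_pos hkn hq h).ne'
    refine (hc.congr ?_).continuousWithinAt
    filter_upwards [ho] with p hp using (sampfordCompletion_of_ne_vertex hp U).symm

/-- On an open face where the completion of `f_U` does not vanish, all coins of bias `1` belong to
`U` and all coins of bias `0` do not. -/
theorem subset_of_sampfordCompletion_pos {A S B U : Finset (Fin n)} {q : Fin n → ℝ}
    (hq : q ∈ openFace A S B) (h : 0 < sampfordCompletion n k U q) :
    B ⊆ U ∧ A ⊆ Uᶜ := by
  suffices hs : ∀ i, sideProb U i q ≠ 0 by
    refine ⟨fun i hi => ?_, fun i hi => ?_⟩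
    · by_contra hU
      exact hs i (by simp [sideProb, hU, hq.2.2 i hi])
    · rw [Finset.mem_compl]
      intro hU
      exact hs i (by simp [sideProb, hU, hq.1 i hi])
  suffices hh : headsProb U q ≠ 0 by
    rw [headsProb, Finset.prod_apply] at hh
    exact fun i => Finset.prod_ne_zero_iff.1 hh i (Finset.mem_univ i)
  by_cases hv : ∃ V, q = vertex V
  · obtain ⟨V, rfl⟩ := hv
    rw [sampfordCompletion_vertex] at h
    rw [headsProb_vertex]
    split_ifs at h ⊢ <;> simp at h ⊢
  · push Not at hv
    intro h0
    rw [sampfordCompletion_of_ne_vertex hv, sampfordRound_apply, h0] at h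
    simp at h

theorem faceProd_le_headsProb {A S B U : Finset (Fin n)} (hAS : Disjoint A S) (hAB : Disjoint A B)
    (hSB : Disjoint S B) (hun : A ∪ S ∪ B = Finset.univ) (hB : B ⊆ U) (hA : A ⊆ Uᶜ)
    {p : Fin n → ℝ} (hp : p ∈ biasCube n) :
    (∏ i ∈ A, (1 - p i)) * (∏ i ∈ S, p i) * (∏ i ∈ S, (1 - p i)) * ∏ i ∈ B, p i ≤
      headsProb U p := by
  have h0 := fun i => (hp i).1
  have h1 := fun i => sub_nonneg.2 (hp i).2
  rw [headsProb, Finset.prod_apply, ← hun,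
    Finset.prod_union (Finset.disjoint_union_left.2 ⟨hAB, hSB⟩), Finset.prod_union hAS,
    mul_assoc (∏ i ∈ A, (1 - p i)), ← Finset.prod_mul_distrib]
  refine mul_le_mul (mul_le_mul (Finset.prod_congr rfl fun i hi => ?_).le
    (Finset.prod_le_prod (fun i _ => mul_nonneg (h0 i) (h1 i)) fun i _ => ?_) ?_ ?_)
    (Finset.prod_congr rfl fun i hi => ?_).le ?_ ?_
  · simp [sideProb, Finset.mem_compl.1 (hA hi)]
  · by_cases hi : i ∈ U
    · simpa [sideProb, hi] using mul_le_of_le_one_right (h0 i) (sub_le_self 1 (h0 i))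
    · simpa [sideProb, hi] using mul_le_of_le_one_left (h1 i) (hp i).2
  · exact Finset.prod_nonneg fun i _ => mul_nonneg (h0 i) (h1 i)
  · exact Finset.prod_nonneg fun i _ => nonneg_of_mem_coinSemiring (sideProb_mem_coinSemiring U i) hp
  · simp [sideProb, hB hi]
  · exact Finset.prod_nonneg fun i _ => h0 i
  · exact mul_nonneg
      (Finset.prod_nonneg fun i _ => nonneg_of_mem_coinSemiring (sideProb_mem_coinSemiring U i) hp)
      (Finset.prod_nonneg fun i _ => nonneg_of_mem_coinSemiring (sideProb_mem_coinSemiring U i) hp)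

/-- For `f` to be polynomially bounded it suffices that at every point where `f` is positive, some
completion of an `f_U` that lies below `f` on the whole domain is positive too. -/
theorem polynomiallyBoundedOn_of_sampfordCompletion_le (hkn : k < n) {m : ℕ}
    (hm : ∀ U : Finset (Fin n), U.card = k →
      sampfordRound n k U - headsProb U ^ (m + 1) * sampfordTotal n k ∈ coinSemiring n)
    {f : (Fin n → ℝ) → ℝ}
    (hf : ∀ q ∈ sampfordDomain n k, 0 < f q → ∃ U : Finset (Fin n), U.card = k ∧
      0 < sampfordCompletion n k U q ∧
      ∀ p ∈ sampfordDomain n k, sampfordCompletion n k U p ≤ f p) :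
    PolynomiallyBoundedOn (sampfordDomain n k) f := by
  refine ⟨m + 1, 1, one_pos, ?_⟩
  rintro A S B hAS hAB hSB hun ⟨q, ⟨hqK, hqF⟩, hq⟩ p hp
  obtain ⟨U, hU, hUq, hUf⟩ := hf q hqK hq
  obtain ⟨hB, hA⟩ := subset_of_sampfordCompletion_pos hqF hUq
  have hpc := sampfordDomain_subset_biasCube hp
  have h0 := fun i => (hpc i).1
  have h1 := fun i => sub_nonneg.2 (hpc i).2
  rw [one_mul]
  refine le_trans (pow_le_pow_left₀ ?_ (faceProd_le_headsProb hAS hAB hSB hun hB hA hpc) (m + 1))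
    ((headsProb_pow_le_sampfordCompletion hkn (hm U hU) hp).trans (hUf p hp))
  exact mul_nonneg (mul_nonneg (mul_nonneg (Finset.prod_nonneg fun i _ => h1 i)
    (Finset.prod_nonneg fun i _ => h0 i)) (Finset.prod_nonneg fun i _ => h1 i))
    (Finset.prod_nonneg fun i _ => h0 i)

theorem polynomiallyBoundedOn_sampfordCompletion (hkn : k < n) {m : ℕ}
    (hm : ∀ U : Finset (Fin n), U.card = k →
      sampfordRound n k U - headsProb U ^ (m + 1) * sampfordTotal n k ∈ coinSemiring n)
    {U : Finset (Fin n)} (hU : U.card = k) :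
    PolynomiallyBoundedOn (sampfordDomain n k) (sampfordCompletion n k U) :=
  polynomiallyBoundedOn_of_sampfordCompletion_le hkn hm fun _ _ h => ⟨U, hU, h, fun _ _ => le_rfl⟩

theorem polynomiallyBoundedOn_one_sub_sampfordCompletion (hkn : k < n) {m : ℕ}
    (hm : ∀ U : Finset (Fin n), U.card = k →
      sampfordRound n k U - headsProb U ^ (m + 1) * sampfordTotal n k ∈ coinSemiring n)
    {U : Finset (Fin n)} (hU : U.card = k) :
    PolynomiallyBoundedOn (sampfordDomain n k) fun p => 1 - sampfordCompletion n k U p := by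
  refine polynomiallyBoundedOn_of_sampfordCompletion_le hkn hm fun q hq h => ?_
  have hUm : U ∈ Finset.powersetCard k Finset.univ := by simpa
  rw [← sum_sampfordCompletion hkn hq, ← Finset.add_sum_erase _ _ hUm, add_sub_cancel_left,
    Finset.sum_pos_iff_of_nonneg fun V _ => sampfordCompletion_nonneg hkn hq V] at h
  obtain ⟨V, hV, hVq⟩ := h
  rw [Finset.mem_erase, Finset.mem_powersetCard_univ] at hV
  refine ⟨V, hV.2, hVq, fun p hp => ?_⟩
  linarith [sampfordCompletion_add_le_one hkn hp hV.2 hU hV.1]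

/-- Flipping the sides of two coins `i ∈ U` and `j ∉ U`. -/
theorem headsProb_swap {U : Finset (Fin n)} {i j : Fin n} (hi : i ∈ U) (hj : j ∉ U)
    (p : Fin n → ℝ) :
    headsProb U p * ((1 - p i) * p j) =
      headsProb (insert j (U.erase i)) p * (p i * (1 - p j)) := by
  have hij : i ≠ j := fun h => hj (h ▸ hi)
  have hi' : i ∈ Finset.univ.erase j := Finset.mem_erase.2 ⟨hij, Finset.mem_univ i⟩
  have hprod : ∏ l ∈ (Finset.univ.erase j).erase i, sideProb (insert j (U.erase i)) l =
      ∏ l ∈ (Finset.univ.erase j).erase i, sideProb U l := by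
    refine Finset.prod_congr rfl fun l hl => ?_
    rw [Finset.mem_erase, Finset.mem_erase] at hl
    funext p
    simp [sideProb, hl.1, hl.2.1]
  rw [headsProb, headsProb, ← Finset.mul_prod_erase _ _ (Finset.mem_univ j),
    ← Finset.mul_prod_erase _ _ hi', ← Finset.mul_prod_erase (a := j) _
      (sideProb (insert j (U.erase i))) (Finset.mem_univ j),
    ← Finset.mul_prod_erase _ (sideProb (insert j (U.erase i))) hi', hprod]
  simp only [Pi.mul_apply]
  rw [sideProb_of_mem hi, sideProb_of_notMem hj, sideProb_of_mem (Finset.mem_insert_self _ _),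
    sideProb_of_notMem (by simp [hij])]
  ring

theorem sum_compl_eq_of_mem_sampfordDomain {p : Fin n → ℝ} (hp : p ∈ sampfordDomain n k)
    {U : Finset (Fin n)} (hU : U.card = k) : ∑ j ∈ Uᶜ, p j = ∑ j ∈ U, (1 - p j) := by
  have h := Finset.sum_add_sum_compl U p
  rw [hp.2] at h
  rw [Finset.sum_sub_distrib, Finset.sum_const, hU, nsmul_eq_mul, mul_one, ← h]
  ring

/-- The exchange identity between the `k`-subsets that contain `i` and those that do not. The pair
`(U, j)` with `i ∈ U` and `j ∉ U` on the left corresponds to `(U \ {i} ∪ {j}, j)` on the right. -/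
theorem sum_sampfordRound_exchange {p : Fin n → ℝ} (hp : p ∈ sampfordDomain n k) (i : Fin n) :
    (1 - p i) * ∑ U ∈ Finset.powersetCard k Finset.univ with i ∈ U, sampfordRound n k U p =
      p i * ∑ U ∈ Finset.powersetCard k Finset.univ with i ∉ U, sampfordRound n k U p := by
  have hl : ∀ U ∈ (Finset.powersetCard k (Finset.univ : Finset (Fin n))).filter (i ∈ ·),
      (1 - p i) * sampfordRound n k U p =
        ∑ j ∈ Uᶜ, 1 / ((n : ℝ) - k) * (headsProb U p * ((1 - p i) * p j)) := by
    intro U _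
    rw [sampfordRound_apply, ← Finset.mul_sum, ← Finset.mul_sum, ← Finset.mul_sum]
    ring
  have hr : ∀ U ∈ (Finset.powersetCard k (Finset.univ : Finset (Fin n))).filter (i ∉ ·),
      p i * sampfordRound n k U p =
        ∑ j ∈ U, 1 / ((n : ℝ) - k) * (headsProb U p * (p i * (1 - p j))) := by
    intro U hU
    rw [Finset.mem_filter, Finset.mem_powersetCard_univ] at hU
    rw [sampfordRound_apply, sum_compl_eq_of_mem_sampfordDomain hp hU.1, ← Finset.mul_sum,
      ← Finset.mul_sum, ← Finset.mul_sum]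
    ring
  rw [Finset.mul_sum, Finset.mul_sum, Finset.sum_congr rfl hl, Finset.sum_congr rfl hr,
    Finset.sum_sigma', Finset.sum_sigma']
  refine Finset.sum_bij' (fun x _ => ⟨insert x.2 (x.1.erase i), x.2⟩)
    (fun x _ => ⟨insert i (x.1.erase x.2), x.2⟩) ?_ ?_ ?_ ?_ ?_
  · rintro ⟨U, j⟩ h
    simp only [Finset.mem_sigma, Finset.mem_filter, Finset.mem_powersetCard_univ,
      Finset.mem_compl] at h ⊢
    obtain ⟨⟨hU, hi⟩, hj⟩ := h
    have hij : i ≠ j := fun h => hj (h ▸ hi)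
    refine ⟨⟨?_, by simp [hij]⟩, by simp⟩
    rw [Finset.card_insert_of_notMem (by simp [hj]), Finset.card_erase_add_one hi, hU]
  · rintro ⟨U, j⟩ h
    simp only [Finset.mem_sigma, Finset.mem_filter, Finset.mem_powersetCard_univ,
      Finset.mem_compl] at h ⊢
    obtain ⟨⟨hU, hi⟩, hj⟩ := h
    have hij : i ≠ j := fun h => hi (h ▸ hj)
    refine ⟨⟨?_, by simp⟩, by simp [hij.symm]⟩
    rw [Finset.card_insert_of_notMem (by simp [hi]), Finset.card_erase_add_one hj, hU]
  · rintro ⟨U, j⟩ h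
    simp only [Finset.mem_sigma, Finset.mem_filter, Finset.mem_compl] at h
    simp [h.2, Finset.insert_erase h.1.2]
  · rintro ⟨U, j⟩ h
    simp only [Finset.mem_sigma, Finset.mem_filter] at h
    simp [h.1.2, Finset.insert_erase h.2]
  · rintro ⟨U, j⟩ h
    simp only [Finset.mem_sigma, Finset.mem_filter, Finset.mem_compl] at h
    simp only
    rw [headsProb_swap h.1.2 h.2]

/-- The inclusion probabilities of Sampford sampling. -/
theorem sum_sampfordCompletion_of_mem (hkn : k < n) {p : Fin n → ℝ} (hp : p ∈ sampfordDomain n k)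
    (i : Fin n) :
    ∑ U ∈ Finset.powersetCard k Finset.univ with i ∈ U, sampfordCompletion n k U p = p i := by
  by_cases h : ∃ V, p = vertex V
  · obtain ⟨V, rfl⟩ := h
    simp [sampfordCompletion_vertex, card_eq_of_vertex_mem hp, vertex]
  · push Not at h
    have hT := sampfordTotal_pos hkn hp h
    simp only [sampfordCompletion_of_ne_vertex h]
    rw [← Finset.sum_div, div_eq_iff hT.ne', sampfordTotal]
    have := Finset.sum_filter_add_sum_filter_not
      (Finset.powersetCard k (Finset.univ : Finset (Fin n))) (i ∈ ·)
      fun U => sampfordRound n k U p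
    rw [← this]
    linear_combination sum_sampfordRound_exchange hp i

end Domain

/-! ### The factory for Sampford sampling -/

section SampfordFactory

variable {n k : ℕ}

namespace Factory

/-- Flipping each coin of `s` once gives a random subset of `s`, the set of heads. -/
theorem exists_samples_heads (s : Finset (Fin n)) :
    ∃ F : Factory n (Finset (Fin n)),
      Samples F fun W p => if W ⊆ s then ∏ i ∈ s, sideProb W i p else 0 := by
  induction s using Finset.induction_on with
  | empty =>
    refine ⟨pure ∅, (samples_pure ∅).congr fun W p => ?_⟩
    simp
  | insert i s hi ih =>
    obtain ⟨F, hF⟩ := ih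
    choose G hG using fun W : Finset (Fin n) => (simulable_coord i).exists_samples_ite
      (samples_pure (insert i W)) (samples_pure W)
    refine ⟨F.bind G, (hF.bind hG).congr fun V p => ?_⟩
    have hcong : ∀ W : Finset (Fin n), (∀ l, l ≠ i → (l ∈ W ↔ l ∈ V)) →
        ∏ l ∈ s, sideProb W l p = ∏ l ∈ s, sideProb V l p := fun W hW =>
      Finset.prod_congr rfl fun l hl => by
        simp only [sideProb, hW l fun h => hi (h ▸ hl)]
    rw [Finset.prod_insert hi]
    by_cases hV : i ∈ V
    · rw [Finset.sum_eq_single (V.erase i)]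
      · have hne : V ≠ V.erase i := fun h => Finset.notMem_erase i V (h ▸ hV)
        rw [if_pos (Finset.insert_erase hV).symm, if_neg hne, hcong (V.erase i)
          fun l hl => by simp [hl], sideProb_of_mem hV]
        simp only [Finset.subset_insert_iff]
        split_ifs
        · ring
        · ring
      · intro W _ hW
        by_cases hWs : W ⊆ s
        · have hiW : i ∉ W := fun h => hi (hWs h)
          have h1 : V ≠ insert i W := by
            rintro rfl
            exact hW (Finset.erase_insert hiW).symm
          have h2 : V ≠ W := by
            rintro rfl
            exact hiW hV
          simp [h1, h2]
        · simp [hWs]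
      · simp
    · rw [Finset.sum_eq_single V]
      · have hne : V ≠ insert i V := fun h => hV (h ▸ Finset.mem_insert_self i V)
        rw [if_neg hne, if_pos rfl, sideProb_of_notMem hV]
        simp only [Finset.subset_insert_iff, Finset.erase_eq_of_notMem hV]
        split_ifs
        · ring
        · ring
      · intro W _ hW
        have h1 : V ≠ insert i W := by
          rintro rfl
          exact hV (Finset.mem_insert_self i W)
        simp [h1, hW.symm]
      · simp

theorem exists_samples_headsProb : ∃ F : Factory n (Finset (Fin n)), Samples F headsProb := by
  obtain ⟨F, hF⟩ := exists_samples_heads (Finset.univ : Finset (Fin n))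
  refine ⟨F, hF.congr fun W p => ?_⟩
  rw [if_pos (Finset.subset_univ W), headsProb, Finset.prod_apply]

theorem simulable_sideProb (U : Finset (Fin n)) (i : Fin n) : Simulable (sideProb U i) := by
  by_cases h : i ∈ U
  · exact sideProb_of_mem h ▸ simulable_coord i
  · rw [sideProb_of_notMem h]
    exact (simulable_coord i).one_sub

theorem simulable_headsProb (U : Finset (Fin n)) : Simulable (headsProb U) := by
  rw [headsProb]
  exact Finset.prod_induction _ Simulable (fun _ _ => Simulable.mul) simulable_one
    fun i _ => simulable_sideProb U i

/-- All coins are flipped in `m + 1` rounds. The output is `some U` if every round gives the same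
`k`-subset `U` of heads. -/
theorem exists_samples_headsProb_pow (k m : ℕ) :
    ∃ (F : Factory n (Option {U : Finset (Fin n) // U.card = k}))
      (q : Option {U : Finset (Fin n) // U.card = k} → (Fin n → ℝ) → ℝ),
      Samples F q ∧ ∀ U p, q (some U) p = headsProb U.1 p ^ (m + 1) := by
  have h : ∀ W : Finset (Fin n), ∃ (G : Factory n (Option {U : Finset (Fin n) // U.card = k}))
      (r : Option {U : Finset (Fin n) // U.card = k} → (Fin n → ℝ) → ℝ),
      Samples G r ∧ ∀ U p, r (some U) p = if W = U.1 then headsProb W p ^ m else 0 := by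
    intro W
    by_cases hW : W.card = k
    · obtain ⟨G, hG⟩ := ((simulable_headsProb W).pow m).exists_samples_ite
        (samples_pure (some (⟨W, hW⟩ : {U : Finset (Fin n) // U.card = k}))) (samples_pure none)
      refine ⟨G, _, hG, fun U p => ?_⟩
      by_cases hU : W = U.1
      · obtain ⟨U, hU'⟩ := U
        subst hU
        simp
      · have : U ≠ ⟨W, hW⟩ := fun h => hU (congrArg Subtype.val h).symm
        simp [hU, this]
    · refine ⟨pure none, _, samples_pure none, fun U p => ?_⟩
      have : W ≠ U.1 := fun h => hW (h ▸ U.2)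
      simp [this]
  choose G r hG hr using h
  obtain ⟨F, hF⟩ := exists_samples_headsProb (n := n)
  refine ⟨_, _, hF.bind hG, fun U p => ?_⟩
  simp [hr, pow_succ']

/-- The repetition of a trial that outputs `some a` with probability `c * N a p` outputs `a` with
probability proportional to `N a p`. The statement is also meaningful, though void, where all `N a p`
vanish and the repetition never ends. -/
theorem toReal_outputProb_loop {α : Type} [Fintype α] {c : ℝ} (hc : 0 < c)
    {N : α → (Fin n → ℝ) → ℝ} {F : Factory n (Option α)}
    (hF : Samples F fun o p => o.elim (1 - c * ∑ a, N a p) fun a => c * N a p)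
    {p : Fin n → ℝ} (hp : p ∈ biasCube n) (a : α) :
    (∑ b, N b p) * (F.loop.outputProb p {a}).toReal = N a p := by
  classical
  have hfin : F.loop.outputProb p {a} ≠ ⊤ :=
    ((outputProb_le_one hp _ _).trans_lt ENNReal.one_lt_top).ne
  have h := outputProb_eq_expect F.loop p {a}
  rw [expect_loop, ← outputProb_eq_expect, expect_eq_sum, Fintype.sum_option] at h
  have hs : ∑ b, F.outputProb p {some b} * (some b).elim (F.loop.outputProb p {a})
      (Set.indicator {a} 1) = F.outputProb p {some a} := by
    rw [Finset.sum_eq_single a]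
    · simp
    · intro b _ hb
      simp [hb]
    · simp
  have h0 := hF.nonneg p hp none
  have h1 := hF.nonneg p hp (some a)
  rw [hs, hF.outputProb_eq p hp, hF.outputProb_eq p hp] at h
  simp only [Option.elim] at h h0 h1
  have h' := congrArg ENNReal.toReal h
  rw [ENNReal.toReal_add (ENNReal.mul_ne_top ENNReal.ofReal_ne_top hfin) ENNReal.ofReal_ne_top,
    ENNReal.toReal_mul, ENNReal.toReal_ofReal h0, ENNReal.toReal_ofReal h1] at h'
  refine mul_left_cancel₀ hc.ne' ?_
  linear_combination h'

end Factory

theorem sum_subtype_card {M : Type*} [AddCommMonoid M] (k : ℕ) (f : Finset (Fin n) → M) :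
    ∑ U : {U : Finset (Fin n) // U.card = k}, f U.1 =
      ∑ U ∈ Finset.powersetCard k Finset.univ, f U :=
  (Finset.sum_subtype _ (fun _ => Finset.mem_powersetCard_univ) f).symm

open Factory in
/-- The factory for Sampford sampling on the whole domain: flip all coins `m + 1` times and output `U`
if all rounds agree on the `k`-subset `U`; otherwise sample from the residual masses
`g_U - headsProb U ^ (m + 1) * ∑ g_V`, which lie in `coinSemiring n`, by repeated trials. The second
phase is not reached at a vertex, and terminates elsewhere whenever it is reached. -/
theorem exists_factory_sampfordCompletion (hkn : k < n) {m : ℕ}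
    (hm : ∀ U : Finset (Fin n), U.card = k →
      sampfordRound n k U - headsProb U ^ (m + 1) * sampfordTotal n k ∈ coinSemiring n) :
    ∃ F : Factory n {U : Finset (Fin n) // U.card = k}, ∀ p ∈ sampfordDomain n k,
      ∀ U, F.outputProb p {U} = ENNReal.ofReal (sampfordCompletion n k U.1 p) := by
  obtain ⟨F₁, q, hF₁, hq⟩ := exists_samples_headsProb_pow (n := n) k m
  obtain ⟨c, hc, -, F₂, hF₂⟩ := exists_samples_const_mul
    (N := fun U : {U : Finset (Fin n) // U.card = k} =>
      sampfordRound n k U.1 - headsProb U.1 ^ (m + 1) * sampfordTotal n k)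
    (fun U => hm U.1 U.2) Finset.univ
  simp only [Finset.mem_univ, if_true] at hF₂
  refine ⟨F₁.bind fun o => o.elim F₂.loop pure, fun p hp U => ?_⟩
  have hpc := sampfordDomain_subset_biasCube hp
  have hloop := toReal_outputProb_loop hc hF₂ hpc U
  have hfin : F₂.loop.outputProb p {U} ≠ ⊤ :=
    ((outputProb_le_one hpc _ _).trans_lt ENNReal.one_lt_top).ne
  have hsum := hF₁.sum_eq_one p hpc
  have hnone := hF₁.nonneg p hpc none
  simp only [Fintype.sum_option, hq, sum_subtype_card k fun U => headsProb U p ^ (m + 1)] at hsum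
  have hN : ∑ V : {U : Finset (Fin n) // U.card = k},
      (sampfordRound n k V.1 - headsProb V.1 ^ (m + 1) * sampfordTotal n k) p =
      q none p * sampfordTotal n k p := by
    rw [sum_subtype_card k fun V =>
      (sampfordRound n k V - headsProb V ^ (m + 1) * sampfordTotal n k) p]
    simp only [Pi.sub_apply, Pi.mul_apply, Pi.pow_apply]
    rw [Finset.sum_sub_distrib, ← Finset.sum_mul, ← sampfordTotal]
    linear_combination (sampfordTotal n k p) * (-hsum)
  rw [hN] at hloop
  have hout : (F₁.bind fun o => o.elim F₂.loop pure).outputProb p {U} = ENNReal.ofReal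
      (q none p * (F₂.loop.outputProb p {U}).toReal + headsProb U.1 p ^ (m + 1)) := by
    rw [outputProb_eq_expect, expect_bind, expect_eq_sum, Fintype.sum_option,
      Finset.sum_eq_single U, ENNReal.ofReal_add (mul_nonneg hnone ENNReal.toReal_nonneg)
        (pow_nonneg (headsProb_nonneg hpc U.1) _), ENNReal.ofReal_mul hnone,
      ENNReal.ofReal_toReal hfin]
    · simp only [Option.elim, ← outputProb_eq_expect, hF₁.outputProb_eq p hpc, hq]
      rw [outputProb_eq_expect (Factory.pure U), expect_pure]
      simp
    · intro V _ hV
      simp [expect_pure, hV]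
    · simp
  rw [hout]
  congr 1
  by_cases h : ∃ V, p = vertex V
  · obtain ⟨V, rfl⟩ := h
    -- The first phase already outputs `V` with probability one.
    have h0 : q none (vertex V) = 0 := by
      simpa [headsProb_vertex, card_eq_of_vertex_mem hp] using hsum
    rw [h0, headsProb_vertex, sampfordCompletion_vertex]
    split_ifs <;> simp
  · push Not at h
    rw [sampfordCompletion_of_ne_vertex h, eq_div_iff (sampfordTotal_pos hkn hp h).ne']
    simp only [Pi.sub_apply, Pi.mul_apply, Pi.pow_apply] at hloop
    linear_combination hloop

open Factory in
theorem implementableOn_sampfordCompletion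
    {F : Factory n {U : Finset (Fin n) // U.card = k}}
    (hF : ∀ p ∈ sampfordDomain n k, F.TerminatesAt p ∧
      ∀ U, F.outputProb p {U} = ENNReal.ofReal (sampfordCompletion n k U.1 p))
    {U : Finset (Fin n)} (hU : U.card = k) :
    ImplementableOn (sampfordDomain n k) (sampfordCompletion n k U) := by
  refine ⟨F.bind fun V => pure (decide (V.1 = U)), fun p hp => ⟨?_, ?_⟩⟩
  · have h := (hF p hp).1
    rw [TerminatesAt, outputProb_eq_expect] at h ⊢
    rw [expect_bind, ← h]
    simp only [expect_pure, Set.indicator_univ]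
    rfl
  · rw [← (hF p hp).2 ⟨U, hU⟩, outputProb_eq_expect, outputProb_eq_expect, expect_bind]
    congr 1
    funext V
    rw [expect_pure]
    by_cases h : V.1 = U
    · obtain ⟨V, hV⟩ := V
      subst h
      simp
    · have : V ≠ ⟨U, hU⟩ := fun e => h (congrArg Subtype.val e)
      simp [h, this]

theorem outputProb_mem_of_sampfordCompletion (hkn : k < n) {p : Fin n → ℝ}
    (hp : p ∈ sampfordDomain n k) {F : Factory n {U : Finset (Fin n) // U.card = k}}
    (hF : ∀ U, F.outputProb p {U} = ENNReal.ofReal (sampfordCompletion n k U.1 p)) (i : Fin n) :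
    F.outputProb p {U | i ∈ U.1} = ENNReal.ofReal (p i) := by
  classical
  rw [Factory.outputProb_eq_sum]
  simp only [hF, Set.mem_ofPred_eq]
  rw [sum_subtype_card k fun U => if i ∈ U then ENNReal.ofReal (sampfordCompletion n k U p) else 0,
    ← Finset.sum_filter, ← ENNReal.ofReal_sum_of_nonneg
      fun U _ => sampfordCompletion_nonneg hkn hp U, sum_sampfordCompletion_of_mem hkn hp]

theorem terminatesAt_of_sampfordCompletion (hkn : k < n) {p : Fin n → ℝ}
    (hp : p ∈ sampfordDomain n k) {F : Factory n {U : Finset (Fin n) // U.card = k}}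
    (hF : ∀ U, F.outputProb p {U} = ENNReal.ofReal (sampfordCompletion n k U.1 p)) :
    F.TerminatesAt p := by
  classical
  rw [Factory.TerminatesAt, Factory.outputProb_eq_sum]
  simp only [hF, Set.mem_univ, if_true]
  rw [sum_subtype_card k fun U => ENNReal.ofReal (sampfordCompletion n k U p),
    ← ENNReal.ofReal_sum_of_nonneg fun U _ => sampfordCompletion_nonneg hkn hp U,
    sum_sampfordCompletion hkn hp, ENNReal.ofReal_one]

end SampfordFactory

theorem mainTheorem3 (n k : ℕ) (hk : 1 ≤ k) (hkn : k < n) :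
    -- Sampford's procedure succeeds with positive probability at every non-vertex of `K`
    (∀ p ∈ sampfordDomain n k, (∀ V : Finset (Fin n), p ≠ vertex V) → 0 < sampfordTotal n k p) ∧
    -- the completions are continuous, polynomially bounded (with their complements), implementable
    (∀ U : Finset (Fin n), U.card = k →
      ContinuousOn (sampfordCompletion n k U) (sampfordDomain n k) ∧
      PolynomiallyBoundedOn (sampfordDomain n k) (sampfordCompletion n k U) ∧
      PolynomiallyBoundedOn (sampfordDomain n k) (fun p => 1 - sampfordCompletion n k U p) ∧
      ImplementableOn (sampfordDomain n k) (sampfordCompletion n k U)) ∧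
    -- one factory, with `k`-subsets as outputs, for Sampford sampling everywhere on `K`
    ∃ F : Factory n {U : Finset (Fin n) // U.card = k}, ∀ p ∈ sampfordDomain n k,
      F.TerminatesAt p ∧
      (∀ U : {U : Finset (Fin n) // U.card = k},
        F.outputProb p {U} = ENNReal.ofReal (sampfordCompletion n k U.1 p)) ∧
      (∀ i : Fin n, F.outputProb p {U | i ∈ U.1} = ENNReal.ofReal (p i)) := by
  obtain ⟨m, hm⟩ := exists_sampfordRound_sub_mem_coinSemiring hkn
  obtain ⟨F, hF⟩ := exists_factory_sampfordCompletion hkn hm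
  have hT := fun p hp => terminatesAt_of_sampfordCompletion hkn hp (hF p hp)
  refine ⟨fun p hp hv => sampfordTotal_pos hkn hp hv, fun U hU => ⟨?_, ?_, ?_, ?_⟩, F,
    fun p hp => ⟨hT p hp, hF p hp, outputProb_mem_of_sampfordCompletion hkn hp (hF p hp)⟩⟩
  · exact continuousOn_sampfordCompletion hkn hm hU
  · exact polynomiallyBoundedOn_sampfordCompletion hkn hm hU
  · exact polynomiallyBoundedOn_one_sub_sampfordCompletion hkn hm hU
  · exact implementableOn_sampfordCompletion (fun p hp => ⟨hT p hp, hF p hp⟩) hU
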